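/- **Theorem 2.5 (Compactness of $G$-convergence).** Let $\mathcal H$ be a separable (real or complex) Hilbert space with inner product $\langle\cdot,\cdot\rangle$, linear in the first entry and antilinear in the second. Let $(L_0,\widetilde L_0)$ be a pair of linear operators on $\mathcal H$ such that - (T1) $L_0$ and $\widetilde L_0$ have a common domain $\mathcal D$, which is dense in $\mathcal H$, and $\langle L_0\varphi,\psi\rangle=\langle\varphi,\widetilde L_0\psi\rangle$ for all $\varphi,\psi\in\mathcal D$; - (T2) there is $\lambda>0$ with $\|(L_0+\widetilde L_0)\varphi\|\le 2\lambda\|\varphi\|$ for all $\varphi\in\mathcal D$. Put $L_1:=\widetilde L_0^{*}$ and $\widetilde L_1:=L_0^{*}$. These operators have the same domain $\mathcal W$, which is a Hilbert space (the graph space) with the graph inner product $\langle u,v\rangle+\langle L_1u,L_1v\rangle$, and $S:=\overline{L_0+\widetilde L_0}$ is a bounded operator defined on all of $\mathcal H$. For $u,v\in\mathcal W$ let $[u\mid v]:=\langle L_1u,v\rangle-\langle u,\widetilde L_1v\rangle$, and for a subspace $\mathcal X\subseteq\mathcal W$ let $\mathcal X^{[\perp]}:=\{u\in\mathcal W:\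 [u\mid v]=0\text{ for all }v\in\mathcal X\}$. Let $\mathcal V$ be a subspace of $\mathcal W$ satisfying condition - (V) with $\widetilde{\mathcal V}:=\mathcal V^{[\perp]}$, one has $\mathcal V=\widetilde{\mathcal V}^{[\perp]}$, $[u\mid u]\ge 0$ for all $u\in\mathcal V$, and $[v\mid v]\le 0$ for all $v\in\widetilde{\mathcal V}$, and let $L:=L_1|_{\mathcal V}$. For $\beta>\alpha>0$ let $\mathcal F(\alpha,\beta;L_0+\widetilde L_0,\mathcal H)$ be the set of bounded linear operators $C$ on $\mathcal H$ such that for all $\varphi\in\mathcal H$ $$\operatorname{Re}\langle (C+\tfrac12 S)\varphi,\varphi\rangle\ge\alpha\|\varphi\|^2,\qquad \operatorname{Re}\langle (C+\tfrac12 S)\varphi,\varphi\rangle\ge\tfrac1\beta\|(C+\tfrac12 S)\varphi\|^2 .$$ Then for every sequence $(C_n)_n$ in $\mathcal F(\alpha,\beta;L_0+\widetilde L_0,\mathcal H)$ there are a strictly increasing sequence of indices $(n_k)_k$ and an operator $C\in\mathcal F(\alpha,\beta;L_0+\widetilde L_0,\mathcal H)$ such that $T_{n_k}:=L+C_{n_k}$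 $G$-converges to $T:=L+C$. That is: with $\mathcal V$ carrying the graph norm, all $T_{n_k}$ and $T$ are isomorphisms (linear homeomorphisms) from $\mathcal V$ onto $\mathcal H$, and for every $f\in\mathcal H$ the sequence $T_{n_k}^{-1}f$ converges to $T^{-1}f$ weakly in $\mathcal W$. -/

import Mathlib

open Filter Topology
open scoped InnerProductSpace ComplexOrder

noncomputable section

namespace AbstractFriedrichs

variable {𝕜 : Type*} [RCLike 𝕜]
variable {H : Type*} [NormedAddCommGroup H] [InnerProductSpace 𝕜 H]

/-- Conditions (T1) and (T2) for a pair of unbounded operators `L₀`, `Lt₀` (read `L̃₀`) on `H`: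
they have a common dense domain, they are formally adjoint to each other, and their sum is
bounded on the common domain. -/
structure IsT1T2 (L₀ Lt₀ : H →ₗ.[𝕜] H) : Prop where
  domain_eq : L₀.domain = Lt₀.domain
  dense_domain : Dense (L₀.domain : Set H)
  formalAdjoint : L₀.IsFormalAdjoint Lt₀
  bounded_sum : ∃ lam : ℝ, 0 < lam ∧
    ∀ φ : (L₀ + Lt₀).domain, ‖(L₀ + Lt₀) φ‖ ≤ 2 * lam * ‖(φ : H)‖

/-- The graph space of an unbounded operator `A`: its domain, with the graph inner product, whose
norm is equivalent to `‖u‖ + ‖A u‖`: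
`⟪u, v⟫ + ⟪A u, A v⟫`. -/
def GraphSpace (A : H →ₗ.[𝕜] H) : Type _ := A.domain

namespace GraphSpace

variable (A : H →ₗ.[𝕜] H)

instance instAddCommGroup : AddCommGroup (GraphSpace A) := inferInstanceAs (AddCommGroup A.domain)

instance instModule : Module 𝕜 (GraphSpace A) := inferInstanceAs (Module 𝕜 A.domain)

/-- The inclusion of the domain in `H`, as a linear map. -/
def valₗ : GraphSpace A →ₗ[𝕜] H := A.domain.subtype

/-- The operator `A` on its domain, as a linear map. -/
def opₗ : GraphSpace A →ₗ[𝕜] H := A.toFun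

/-- The graph inner product. -/
@[reducible]
def core : InnerProductSpace.Core 𝕜 (GraphSpace A) where
  inner u v := ⟪valₗ A u, valₗ A v⟫_𝕜 + ⟪opₗ A u, opₗ A v⟫_𝕜
  conj_inner_symm u v := by simp
  re_inner_nonneg u := by
    rw [map_add]
    exact add_nonneg inner_self_nonneg inner_self_nonneg
  add_left u v w := by
    simp only [map_add, inner_add_left]
    ring
  smul_left u v r := by
    simp only [map_smul, inner_smul_left]
    ring
  definite u hu := by
    have h1 : RCLike.re (⟪valₗ A u, valₗ A u⟫_𝕜 + ⟪opₗ A u, opₗ A u⟫_𝕜) = 0 := by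
      rw [show ⟪valₗ A u, valₗ A u⟫_𝕜 + ⟪opₗ A u, opₗ A u⟫_𝕜 = 0 from hu, map_zero]
    rw [map_add] at h1
    have h2 : RCLike.re ⟪valₗ A u, valₗ A u⟫_𝕜 = 0 := by
      have ha : 0 ≤ RCLike.re ⟪valₗ A u, valₗ A u⟫_𝕜 := inner_self_nonneg
      have hb : 0 ≤ RCLike.re ⟪opₗ A u, opₗ A u⟫_𝕜 := inner_self_nonneg
      linarith
    rw [inner_self_eq_norm_sq, sq_eq_zero_iff, norm_eq_zero] at h2
    exact Subtype.ext h2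

instance instNormedAddCommGroup : NormedAddCommGroup (GraphSpace A) :=
  (core A).toNormedAddCommGroup

instance instInnerProductSpace : InnerProductSpace 𝕜 (GraphSpace A) :=
  InnerProductSpace.ofCore (core A).toCore

theorem inner_def (u v : GraphSpace A) :
    ⟪u, v⟫_𝕜 = ⟪valₗ A u, valₗ A v⟫_𝕜 + ⟪opₗ A u, opₗ A v⟫_𝕜 := rfl

theorem norm_sq_eq (u : GraphSpace A) : ‖u‖ ^ 2 = ‖valₗ A u‖ ^ 2 + ‖opₗ A u‖ ^ 2 := by
  rw [← inner_self_eq_norm_sq (𝕜 := 𝕜) u, inner_def, map_add, inner_self_eq_norm_sq,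
    inner_self_eq_norm_sq]

/-- The continuous inclusion of the graph space in `H`. -/
def val : GraphSpace A →L[𝕜] H :=
  (valₗ A).mkContinuous 1 fun u => by
    rw [one_mul]
    refine le_of_sq_le_sq ?_ (norm_nonneg _)
    rw [norm_sq_eq]
    exact le_add_of_nonneg_right (sq_nonneg _)

/-- The operator `A` itself, as a bounded operator from its graph space to `H`. -/
def op : GraphSpace A →L[𝕜] H :=
  (opₗ A).mkContinuous 1 fun u => by
    rw [one_mul]
    refine le_of_sq_le_sq ?_ (norm_nonneg _)
    rw [norm_sq_eq]
    exact le_add_of_nonneg_left (sq_nonneg _)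

end GraphSpace

section Pair

variable [CompleteSpace H] {L₀ Lt₀ : H →ₗ.[𝕜] H}

theorem IsT1T2.closure_sum (h : IsT1T2 L₀ Lt₀) : ∃ S : H →L[𝕜] H,
    (L₀ + Lt₀).closure = (S : H →ₗ[𝕜] H).toPMap ⊤ := by
  obtain ⟨lam, -, hb⟩ := h.bounded_sum
  set f := L₀ + Lt₀ with hf
  have hd : Dense (f.domain : Set H) := by
    have : f.domain = L₀.domain := by
      rw [hf, LinearPMap.add_domain, ← h.domain_eq, inf_idem]
    rw [this]
    exact h.dense_domain
  let g : f.domain →L[𝕜] H := f.toFun.mkContinuous (2 * lam) hb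
  let S : H →L[𝕜] H := g.extend f.domain.subtypeL
  have hS : ∀ x : f.domain, S (x : H) = f x := fun x =>
    ContinuousLinearMap.extend_eq g hd.denseRange_val
      isUniformEmbedding_subtype_val.isUniformInducing x
  have hmem : ∀ p : H × H, p ∈ ((S : H →ₗ[𝕜] H).toPMap ⊤).graph ↔ p.2 = S p.1 := by
    intro p
    rw [LinearPMap.mem_graph_iff]
    constructor
    · rintro ⟨y, h1, h2⟩
      rw [← h2, ← h1]
      rfl
    · intro hp
      exact ⟨⟨p.1, Submodule.mem_top⟩, rfl, hp.symm⟩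
  have hgr : f.graph.topologicalClosure = ((S : H →ₗ[𝕜] H).toPMap ⊤).graph := by
    apply le_antisymm
    · apply Submodule.topologicalClosure_minimal
      · intro p hp
        obtain ⟨y, h1, h2⟩ := (LinearPMap.mem_graph_iff f).1 hp
        rw [hmem, ← h1, ← h2, hS]
      · have : (((S : H →ₗ[𝕜] H).toPMap ⊤).graph : Set (H × H)) = {p | p.2 = S p.1} := by
          ext p
          exact hmem p
        rw [this]
        exact isClosed_eq continuous_snd (S.continuous.comp continuous_fst)
    · intro p hp
      have hp' : p = (p.1, S p.1) := Prod.ext rfl ((hmem p).1 hp)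
      have hc : Continuous fun x : H => (x, S x) := continuous_id.prodMk S.continuous
      have hx : p.1 ∈ _root_.closure (f.domain : Set H) := hd p.1
      have := image_closure_subset_closure_image hc (Set.mem_image_of_mem _ hx)
      rw [← hp'] at this
      rw [← SetLike.mem_coe, Submodule.topologicalClosure_coe]
      refine closure_mono ?_ this
      rintro _ ⟨x, hx, rfl⟩
      exact (LinearPMap.mem_graph_iff f).2 ⟨⟨x, hx⟩, rfl, (hS ⟨x, hx⟩).symm⟩
  have hcl : f.IsClosable := ⟨_, hgr⟩
  refine ⟨S, LinearPMap.eq_of_eq_graph ?_⟩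
  rw [← hcl.graph_closure_eq_closure_graph, hgr]

/-- The closure of `L₀ + L̃₀`, which is a bounded operator defined on all of `H`. -/
def IsT1T2.closureSum (h : IsT1T2 L₀ Lt₀) : H →L[𝕜] H := h.closure_sum.choose

theorem IsT1T2.closureSum_spec (h : IsT1T2 L₀ Lt₀) :
    (L₀ + Lt₀).closure = (h.closureSum : H →ₗ[𝕜] H).toPMap ⊤ :=
  h.closure_sum.choose_spec

theorem IsT1T2.closureSum_apply (h : IsT1T2 L₀ Lt₀) (x : L₀.domain) (y : Lt₀.domain)
    (hxy : (x : H) = y) : h.closureSum (x : H) = L₀ x + Lt₀ y := by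
  obtain ⟨x, hx⟩ := x
  obtain ⟨y, hy⟩ := y
  obtain rfl : x = y := hxy
  have hle := (L₀ + Lt₀).le_closure
  rw [h.closureSum_spec] at hle
  exact (hle.2 (x := ⟨x, hx, hy⟩) (y := ⟨x, Submodule.mem_top⟩) rfl).symm

/-- The adjoints `L₁ = L̃₀*` and `L̃₁ = L₀*` have the same domain. -/
theorem IsT1T2.domain_adjoint_eq (h : IsT1T2 L₀ Lt₀) :
    Lt₀.adjoint.domain = L₀.adjoint.domain := by
  have key : ∀ x : H, Continuous ((innerₛₗ 𝕜 x).comp Lt₀.toFun) ↔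
      Continuous ((innerₛₗ 𝕜 x).comp L₀.toFun) := by
    intro x
    have hc : Continuous fun y : L₀.domain => ⟪x, h.closureSum (y : H)⟫_𝕜 :=
      continuous_const.inner (h.closureSum.continuous.comp continuous_subtype_val)
    have hc' : Continuous fun y : Lt₀.domain => ⟪x, h.closureSum (y : H)⟫_𝕜 :=
      continuous_const.inner (h.closureSum.continuous.comp continuous_subtype_val)
    have m1 : ∀ y : L₀.domain, (y : H) ∈ Lt₀.domain := fun y => h.domain_eq.le y.2
    have m2 : ∀ y : Lt₀.domain, (y : H) ∈ L₀.domain := fun y => h.domain_eq.ge y.2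
    have e1 : Continuous fun y : L₀.domain => (⟨y, m1 y⟩ : Lt₀.domain) :=
      continuous_subtype_val.subtype_mk _
    have e2 : Continuous fun y : Lt₀.domain => (⟨y, m2 y⟩ : L₀.domain) :=
      continuous_subtype_val.subtype_mk _
    constructor
    · intro hx
      refine (hc.sub (hx.comp e1)).congr fun y => ?_
      change ⟪x, h.closureSum (y : H)⟫_𝕜 - ⟪x, Lt₀ ⟨y, m1 y⟩⟫_𝕜 = ⟪x, L₀ y⟫_𝕜
      rw [h.closureSum_apply y ⟨y, m1 y⟩ rfl, inner_add_right, add_sub_cancel_right]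
    · intro hx
      refine (hc'.sub (hx.comp e2)).congr fun y => ?_
      change ⟪x, h.closureSum (y : H)⟫_𝕜 - ⟪x, L₀ ⟨y, m2 y⟩⟫_𝕜 = ⟪x, Lt₀ y⟫_𝕜
      rw [h.closureSum_apply ⟨y, m2 y⟩ y rfl, inner_add_right, add_sub_cancel_left]
  ext x
  rw [LinearPMap.mem_adjoint_domain_iff, LinearPMap.mem_adjoint_domain_iff]
  exact key x

/-- The class `F(α, β; L₀ + L̃₀, H)` of bounded operators `C` on `H`. -/
def IsT1T2.coeffClass (h : IsT1T2 L₀ Lt₀) (α β : ℝ) : Set (H →L[𝕜] H) :=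
  {C | ∀ φ : H,
    α * ‖φ‖ ^ 2 ≤ RCLike.re ⟪φ, (C + (1 / 2 : 𝕜) • h.closureSum) φ⟫_𝕜 ∧
    1 / β * ‖(C + (1 / 2 : 𝕜) • h.closureSum) φ‖ ^ 2 ≤
      RCLike.re ⟪φ, (C + (1 / 2 : 𝕜) • h.closureSum) φ⟫_𝕜}

/-- The graph space `W` of `L₁ = L̃₀*`. -/
abbrev IsT1T2.W (_h : IsT1T2 L₀ Lt₀) : Type _ := GraphSpace Lt₀.adjoint

/-- The embedding of `W` in `H`. -/
def IsT1T2.incl (h : IsT1T2 L₀ Lt₀) : h.W →L[𝕜] H := GraphSpace.val Lt₀.adjoint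

/-- The operator `L₁ = L̃₀*` on its graph space. -/
def IsT1T2.L₁ (h : IsT1T2 L₀ Lt₀) : h.W →L[𝕜] H := GraphSpace.op Lt₀.adjoint

/-- The operator `L̃₁ = L₀*`, whose domain is also `W`. -/
def IsT1T2.Lt₁ (h : IsT1T2 L₀ Lt₀) : h.W →ₗ[𝕜] H :=
  L₀.adjoint.toFun ∘ₗ Submodule.inclusion h.domain_adjoint_eq.le

/-- The indefinite inner product `[u | v] = ⟨L₁ u, v⟩ - ⟨u, L̃₁ v⟩` on `W`, where `⟨x, y⟩`, linear
in `x` and antilinear in `y`, is `⟪y, x⟫_𝕜` in Mathlib's convention. -/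
def IsT1T2.form (h : IsT1T2 L₀ Lt₀) (u v : h.W) : 𝕜 :=
  ⟪h.incl v, h.L₁ u⟫_𝕜 - ⟪h.Lt₁ v, h.incl u⟫_𝕜

/-- The orthogonal complement `{u ∈ W | ∀ v ∈ V, [u | v] = 0}`. -/
def IsT1T2.perp (h : IsT1T2 L₀ Lt₀) (V : Submodule 𝕜 h.W) : Submodule 𝕜 h.W where
  carrier := {u | ∀ v ∈ V, h.form u v = 0}
  add_mem' := by
    intro a b ha hb v hv
    have h1 := ha v hv
    have h2 := hb v hv
    simp only [IsT1T2.form, map_add, inner_add_right] at h1 h2 ⊢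
    linear_combination h1 + h2
  zero_mem' := by
    intro v _
    simp [IsT1T2.form]
  smul_mem' := by
    intro c a ha v hv
    have h1 := ha v hv
    simp only [IsT1T2.form, map_smul, inner_smul_right] at h1 ⊢
    linear_combination c * h1

/-- Condition (V) on a subspace `V` of `W`: with `Ṽ` the complement of `V`, the complement of `Ṽ`
is `V`, the form is nonnegative on `V` and nonpositive on `Ṽ`. (In the order of `𝕜`, being
nonnegative or nonpositive includes being real.) -/
structure IsT1T2.ConditionV (h : IsT1T2 L₀ Lt₀) (V : Submodule 𝕜 h.W) : Prop where
  perp_perp : V = h.perp (h.perp V)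
  nonneg : ∀ u ∈ V, 0 ≤ h.form u u
  nonpos : ∀ v ∈ h.perp V, h.form v v ≤ 0

/-- The operator `L + C : V → H`, where `L` is the restriction of `L₁` to `V`, and `V` carries the
graph norm. -/
def IsT1T2.realisation (h : IsT1T2 L₀ Lt₀) (V : Submodule 𝕜 h.W) (C : H →L[𝕜] H) : V →L[𝕜] H :=
  (h.L₁ + C ∘L h.incl) ∘L V.subtypeL

/-- G-convergence of the isomorphisms `Tₙ = L + Cₙ : V → H` to the isomorphism `T = L + C : V → H`:
for each `f ∈ H`, the sequence `Tₙ⁻¹ f` converges to `T⁻¹ f` weakly in `W`. Being an isomorphism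
(linear homeomorphism) is part of the definition. -/
structure IsT1T2.GConverges (h : IsT1T2 L₀ Lt₀) (V : Submodule 𝕜 h.W) (C : ℕ → H →L[𝕜] H)
    (Climit : H →L[𝕜] H) : Prop where
  isInvertible : ∀ n, (h.realisation V (C n)).IsInvertible
  isInvertible_limit : (h.realisation V Climit).IsInvertible
  tendsto : ∀ f : H,
    Tendsto (fun n => toWeakSpace 𝕜 h.W (((h.realisation V (C n)).inverse f : V) : h.W)) atTop
      (𝓝 (toWeakSpace 𝕜 h.W (((h.realisation V Climit).inverse f : V) : h.W)))

end Pair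

end AbstractFriedrichs

end

/-!
The operator `L + C` is treated as `M + A`, with `M = L₁ - ½ S` (`IsT1T2.skewPart`) and
`A = C + ½ S`. The symmetry of `S` gives `[u | v] = ⟪v, M u⟫ + ⟪M v, u⟫` (`IsT1T2.form_eq`), so that
condition (V) says that `M` is accretive on `V` and that `-M` is accretive on the complement of `V`.
Together with the coercivity of `A`, the first fact gives the estimate `‖u‖ ≤ K ‖(L + C) u‖` in the
graph norm, with `K` independent of `C` in the class (`ConditionV.norm_le`), and the second one shows
that the range of `L + C` is dense. Hence `L + C` is an isomorphism of `V` onto `H`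
(`ConditionV.isInvertible_realisation`).

The inverses `Tₙ⁻¹ : H → V` are uniformly bounded, and a diagonal argument gives a subsequence that
converges to some `B : H → V` in the weak operator topology (`exists_subseq_tendsto_inner`). Let
`f ∈ H`, `uₙ = Tₙ⁻¹ f ⇀ u = B f`. Then `Aₙ uₙ = f - M uₙ ⇀ w = f - M u`. As `u ↦ re ⟪u, M u⟫` is a
nonnegative quadratic form on `V`, it is weakly lower semicontinuous, so
`limsup re ⟪uₙ, Aₙ uₙ⟫ ≤ re ⟪u, w⟫`; therefore both inequalities that define the class hold for the
pair `(u, w)` (`ConditionV.coercive_of_tendsto`), and no compact embedding is needed.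

These inequalities give `‖w‖ ≤ β ‖u‖` and the density of the range of `B` in `H`, so that `B f ↦ w`
extends to a bounded operator `A` on `H` that satisfies them for all vectors. Then `C = A - ½ S` is
in the class and `(L + C) B = id` (`exists_realisation_comp_eq_id`), that is, `B = (L + C)⁻¹`.
-/

namespace AbstractFriedrichs

/-! ### Weak convergence in separable Hilbert spaces -/

section WeakCompactness

theorem cauchySeq_of_lipschitzWith_of_dense {E F : Type*} [PseudoMetricSpace E]
    [PseudoMetricSpace F] {K : NNReal} {g : ℕ → E → F} (hg : ∀ n, LipschitzWith K (g n))
    {s : Set E} (hs : Dense s) (hc : ∀ x ∈ s, CauchySeq fun n => g n x) (x : E) :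
    CauchySeq fun n => g n x := by
  rw [Metric.cauchySeq_iff']
  intro ε hε
  obtain ⟨y, hys, hy⟩ := hs.exists_dist_lt x (show 0 < ε / (3 * (K + 1)) by positivity)
  have hK : ∀ n, dist (g n x) (g n y) < ε / 3 := by
    intro n
    have h1 : (K : ℝ) * dist x y ≤ (K + 1) * dist x y :=
      mul_le_mul_of_nonneg_right (by linarith) dist_nonneg
    have h2 : ((K : ℝ) + 1) * dist x y < (K + 1) * (ε / (3 * (K + 1))) :=
      mul_lt_mul_of_pos_left hy (by positivity)
    have h3 : ((K : ℝ) + 1) * (ε / (3 * (K + 1))) = ε / 3 := by field_simp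
    linarith [(hg n).dist_le_mul x y]
  obtain ⟨N, hN⟩ := Metric.cauchySeq_iff'.1 (hc y hys) (ε / 3) (by positivity)
  refine ⟨N, fun n hn => ?_⟩
  have h1 := dist_triangle4 (g n x) (g n y) (g N y) (g N x)
  have h2 := hK N
  rw [dist_comm] at h2
  linarith [hK n, hN n hn]

variable {𝕜 : Type*} [RCLike 𝕜]

/-- Bounded sequences of operators into a separable Hilbert space are sequentially relatively
compact in the weak operator topology. -/
theorem exists_subseq_tendsto_inner {X Y : Type*} [NormedAddCommGroup X] [NormedSpace 𝕜 X]
    [TopologicalSpace.SeparableSpace X] [NormedAddCommGroup Y] [InnerProductSpace 𝕜 Y]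
    [CompleteSpace Y] [TopologicalSpace.SeparableSpace Y] (B : ℕ → X →L[𝕜] Y) {M : ℝ}
    (hM : 0 ≤ M) (hB : ∀ n x, ‖B n x‖ ≤ M * ‖x‖) :
    ∃ (k : ℕ → ℕ) (B' : X →L[𝕜] Y), StrictMono k ∧
      ∀ x y, Tendsto (fun n => ⟪B (k n) x, y⟫_𝕜) atTop (𝓝 ⟪B' x, y⟫_𝕜) := by
  have hb : ∀ n x y, ‖⟪B n x, y⟫_𝕜‖ ≤ M * ‖x‖ * ‖y‖ := fun n x y =>
    (norm_inner_le_norm _ _).trans (mul_le_mul_of_nonneg_right (hB n x) (norm_nonneg y))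
  -- Diagonal extraction: the countable product of closed balls is compact and first countable.
  let F : ℕ → ℕ × ℕ → 𝕜 := fun n p =>
    ⟪B n (TopologicalSpace.denseSeq X p.1), TopologicalSpace.denseSeq Y p.2⟫_𝕜
  have hcpt : IsCompact (Set.univ.pi fun p : ℕ × ℕ => Metric.closedBall (0 : 𝕜)
      (M * ‖TopologicalSpace.denseSeq X p.1‖ * ‖TopologicalSpace.denseSeq Y p.2‖)) :=
    isCompact_univ_pi fun p => isCompact_closedBall _ _
  obtain ⟨a, -, k, hk, ha⟩ := hcpt.tendsto_subseq (x := F) fun n p _ => by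
    rw [mem_closedBall_zero_iff]
    exact hb _ _ _
  rw [tendsto_pi_nhds] at ha
  have hc₁ : ∀ i y, CauchySeq fun n => ⟪B (k n) (TopologicalSpace.denseSeq X i), y⟫_𝕜 := by
    intro i
    refine cauchySeq_of_lipschitzWith_of_dense
      (K := (M * ‖TopologicalSpace.denseSeq X i‖).toNNReal) ?_
      (TopologicalSpace.denseRange_denseSeq Y) ?_
    · refine fun n => LipschitzWith.of_dist_le_mul fun y z => ?_
      rw [dist_eq_norm, dist_eq_norm, ← inner_sub_right,
        Real.coe_toNNReal _ (mul_nonneg hM (norm_nonneg _))]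
      exact hb _ _ _
    · rintro _ ⟨j, rfl⟩
      exact (ha (i, j)).cauchySeq
  have hc : ∀ x y, CauchySeq fun n => ⟪B (k n) x, y⟫_𝕜 := by
    intro x y
    refine cauchySeq_of_lipschitzWith_of_dense (K := (M * ‖y‖).toNNReal)
      (g := fun n x => ⟪B (k n) x, y⟫_𝕜) ?_ (TopologicalSpace.denseRange_denseSeq X) ?_ x
    · refine fun n => LipschitzWith.of_dist_le_mul fun x z => ?_
      rw [dist_eq_norm, dist_eq_norm, ← inner_sub_left, ← map_sub,
        Real.coe_toNNReal _ (mul_nonneg hM (norm_nonneg _)), mul_right_comm]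
      exact hb _ _ _
    · rintro _ ⟨i, rfl⟩
      exact hc₁ i y
  choose b hlim using fun x y => cauchySeq_tendsto_of_complete (hc x y)
  let bₗ : X →ₗ⋆[𝕜] Y →ₗ[𝕜] 𝕜 := LinearMap.mk₂'ₛₗ (starRingEnd 𝕜) (RingHom.id 𝕜) b
    (fun x x' y => tendsto_nhds_unique (hlim _ _) <| by
      simpa only [map_add, inner_add_left] using (hlim x y).add (hlim x' y))
    (fun c x y => tendsto_nhds_unique (hlim _ _) <| by
      simpa only [map_smul, inner_smul_left, smul_eq_mul] using! (hlim x y).const_mul _)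
    (fun x y y' => tendsto_nhds_unique (hlim _ _) <| by
      simpa only [inner_add_right] using (hlim x y).add (hlim x y'))
    (fun c x y => tendsto_nhds_unique (hlim _ _) <| by
      simpa only [inner_smul_right, smul_eq_mul, RingHom.id_apply] using (hlim x y).const_mul c)
  let b' : X →L⋆[𝕜] Y →L[𝕜] 𝕜 := bₗ.mkContinuous₂ M fun x y =>
    le_of_tendsto (hlim x y).norm (Eventually.of_forall fun n => hb _ x y)
  refine ⟨k, ((InnerProductSpace.toDual 𝕜 Y).symm.toContinuousLinearEquiv :
    StrongDual 𝕜 Y →L⋆[𝕜] Y).comp b', hk, fun x y => ?_⟩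
  have : ⟪(InnerProductSpace.toDual 𝕜 Y).symm (b' x), y⟫_𝕜 = b x y :=
    InnerProductSpace.toDual_symm_apply
  simpa [this] using! hlim x y

/-- Weak sequential lower semicontinuity of the square of the norm. -/
theorem norm_sq_le_of_tendsto_inner {Y : Type*} [NormedAddCommGroup Y] [InnerProductSpace 𝕜 Y]
    {x : ℕ → Y} {x' : Y} (hx : ∀ y, Tendsto (fun n => ⟪x n, y⟫_𝕜) atTop (𝓝 ⟪x', y⟫_𝕜))
    {c : ℝ} (hc : 0 ≤ c) {r : ℕ → ℝ} {r' : ℝ} (hr : Tendsto r atTop (𝓝 r'))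
    (hxr : ∀ n, c * ‖x n‖ ^ 2 ≤ r n) : c * ‖x'‖ ^ 2 ≤ r' := by
  have h1 : Tendsto (fun n => c * (2 * RCLike.re ⟪x n, x'⟫_𝕜 - ‖x'‖ ^ 2)) atTop
      (𝓝 (c * (2 * RCLike.re ⟪x', x'⟫_𝕜 - ‖x'‖ ^ 2))) :=
    ((((RCLike.continuous_re.tendsto _).comp (hx x')).const_mul 2).sub_const _).const_mul c
  have h2 := le_of_tendsto_of_tendsto' h1 hr fun n => by
    refine le_trans (mul_le_mul_of_nonneg_left ?_ hc) (hxr n)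
    have h3 := norm_sub_sq (𝕜 := 𝕜) (x n) x'
    nlinarith [sq_nonneg ‖x n - x'‖]
  rw [inner_self_eq_norm_sq] at h2
  linarith

/-- Convergence against all inner products in a complete subspace `V` of `W` is weak convergence
in `W`: a functional on `W` restricts to a functional on `V`. -/
theorem tendsto_toWeakSpace_of_tendsto_inner {W : Type*} [NormedAddCommGroup W]
    [InnerProductSpace 𝕜 W] {V : Submodule 𝕜 W} [CompleteSpace V] {u : ℕ → V} {u' : V}
    (hlim : ∀ y, Tendsto (fun n => ⟪u n, y⟫_𝕜) atTop (𝓝 ⟪u', y⟫_𝕜)) :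
    Tendsto (fun n => toWeakSpace 𝕜 W (u n : W)) atTop (𝓝 (toWeakSpace 𝕜 W (u' : W))) := by
  refine (IsInducing.induced _).tendsto_nhds_iff.2
    (tendsto_pi_nhds.2 fun l : StrongDual 𝕜 W => ?_)
  have hl : ∀ v : V, l (v : W) =
      starRingEnd 𝕜 ⟪v, (InnerProductSpace.toDual 𝕜 V).symm (l ∘L V.subtypeL)⟫_𝕜 := fun v => by
    rw [inner_conj_symm, InnerProductSpace.toDual_symm_apply]
    rfl
  change Tendsto (fun n => l (u n : W)) atTop (𝓝 (l (u' : W)))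
  simp only [hl]
  exact (RCLike.continuous_conj.tendsto _).comp (hlim _)

/-- A real-part lower bound `c ‖y‖² ≤ re ⟪x, y⟫` controls `y` linearly by `x`. -/
theorem mul_norm_le_of_mul_sq_le_re_inner {Y : Type*} [NormedAddCommGroup Y]
    [InnerProductSpace 𝕜 Y] {c : ℝ} {x y : Y} (hxy : c * ‖y‖ ^ 2 ≤ RCLike.re ⟪x, y⟫_𝕜) :
    c * ‖y‖ ≤ ‖x‖ := by
  have h := re_inner_le_norm (𝕜 := 𝕜) x y
  rcases (norm_nonneg y).eq_or_lt with h0 | h0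
  · rw [← h0, mul_zero]
    exact norm_nonneg x
  · refine le_of_mul_le_mul_right ?_ h0
    nlinarith

end WeakCompactness

/-! ### The graph space as a separable Hilbert space -/

section Graph

variable {𝕜 : Type*} [RCLike 𝕜] {H : Type*} [NormedAddCommGroup H] [InnerProductSpace 𝕜 H]

namespace GraphSpace

variable (A : H →ₗ.[𝕜] H)

theorem norm_le_add (u : GraphSpace A) : ‖u‖ ≤ ‖val A u‖ + ‖op A u‖ := by
  have h := norm_sq_eq A u
  change ‖u‖ ^ 2 = ‖val A u‖ ^ 2 + ‖op A u‖ ^ 2 at h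
  refine le_of_sq_le_sq ?_ (by positivity)
  nlinarith [mul_nonneg (norm_nonneg (val A u)) (norm_nonneg (op A u))]

theorem isUniformEmbedding_graph : IsUniformEmbedding ((val A).prod (op A)) := by
  refine ((val A).prod (op A)).antilipschitz_of_bound (K := 2) (fun u => ?_)
    |>.isUniformEmbedding ((val A).prod (op A)).uniformContinuous
  have h1 := norm_le_add A u
  have h2 : ‖val A u‖ ≤ ‖((val A).prod (op A)) u‖ := norm_fst_le (((val A).prod (op A)) u)
  have h3 : ‖op A u‖ ≤ ‖((val A).prod (op A)) u‖ := norm_snd_le (((val A).prod (op A)) u)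
  rw [NNReal.coe_ofNat]
  linarith

instance [TopologicalSpace.SeparableSpace H] : SecondCountableTopology (GraphSpace A) :=
  haveI := UniformSpace.secondCountable_of_separable H
  (isUniformEmbedding_graph A).isEmbedding.secondCountableTopology

theorem completeSpace [CompleteSpace H] (hA : A.IsClosed) : CompleteSpace (GraphSpace A) := by
  rw [completeSpace_iff_isComplete_range (isUniformEmbedding_graph A).isUniformInducing]
  have : Set.range ((val A).prod (op A)) = (A.graph : Set (H × H)) := by
    ext p
    rw [SetLike.mem_coe, LinearPMap.mem_graph_iff]
    exact ⟨fun ⟨u, hu⟩ => ⟨u, congrArg Prod.fst hu, congrArg Prod.snd hu⟩,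
      fun ⟨u, h1, h2⟩ => ⟨u, Prod.ext h1 h2⟩⟩
  rw [this]
  exact IsClosed.isComplete hA

end GraphSpace

end Graph

/-! ### The skew part of `L₁` and the indefinite form -/

section PairLemmas

variable {𝕜 : Type*} [RCLike 𝕜] {H : Type*} [NormedAddCommGroup H] [InnerProductSpace 𝕜 H]
variable [CompleteSpace H] {L₀ Lt₀ : H →ₗ.[𝕜] H}

namespace IsT1T2

omit [CompleteSpace H] in
theorem dense_domain' (h : IsT1T2 L₀ Lt₀) : Dense (Lt₀.domain : Set H) :=
  h.domain_eq ▸ h.dense_domain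

theorem inner_closureSum_left (h : IsT1T2 L₀ Lt₀) (x y : H) :
    ⟪h.closureSum x, y⟫_𝕜 = ⟪x, h.closureSum y⟫_𝕜 := by
  refine h.dense_domain.induction (P := fun x => ⟪h.closureSum x, y⟫_𝕜 = ⟪x, h.closureSum y⟫_𝕜)
    (fun x hx => ?_) (isClosed_eq (by fun_prop) (by fun_prop)) x
  refine h.dense_domain.induction (P := fun y => ⟪h.closureSum x, y⟫_𝕜 = ⟪x, h.closureSum y⟫_𝕜)
    (fun y hy => ?_) (isClosed_eq (by fun_prop) (by fun_prop)) y
  have hx' := h.domain_eq.le hx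
  have hy' := h.domain_eq.le hy
  rw [h.closureSum_apply ⟨x, hx⟩ ⟨x, hx'⟩ rfl, h.closureSum_apply ⟨y, hy⟩ ⟨y, hy'⟩ rfl,
    inner_add_left, inner_add_right, h.formalAdjoint ⟨x, hx⟩ ⟨y, hy'⟩,
    h.formalAdjoint.symm ⟨x, hx'⟩ ⟨y, hy⟩, add_comm]

theorem inner_L₁ (h : IsT1T2 L₀ Lt₀) (u : h.W) (φ : Lt₀.domain) :
    ⟪h.L₁ u, (φ : H)⟫_𝕜 = ⟪h.incl u, Lt₀ φ⟫_𝕜 :=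
  LinearPMap.adjoint_isFormalAdjoint h.dense_domain' u φ

theorem inner_Lt₁ (h : IsT1T2 L₀ Lt₀) (u : h.W) (φ : L₀.domain) :
    ⟪h.Lt₁ u, (φ : H)⟫_𝕜 = ⟪h.incl u, L₀ φ⟫_𝕜 :=
  LinearPMap.adjoint_isFormalAdjoint h.dense_domain
    (Submodule.inclusion h.domain_adjoint_eq.le u) φ

theorem L₁_add_Lt₁ (h : IsT1T2 L₀ Lt₀) (u : h.W) :
    h.L₁ u + h.Lt₁ u = h.closureSum (h.incl u) := by
  refine h.dense_domain.eq_of_inner_left 𝕜 fun φ hφ => ?_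
  rw [inner_add_left, h.inner_L₁ u ⟨φ, h.domain_eq.le hφ⟩, h.inner_Lt₁ u ⟨φ, hφ⟩,
    h.inner_closureSum_left, h.closureSum_apply ⟨φ, hφ⟩ ⟨φ, h.domain_eq.le hφ⟩ rfl,
    inner_add_right, add_comm]

/-- The part `L₁ - ½ S` of `L₁`, which is formally skew-adjoint on the common domain of `L₀` and
`L̃₀`: the form `[u | v]` only sees this part. -/
noncomputable def skewPart (h : IsT1T2 L₀ Lt₀) : h.W →L[𝕜] H :=
  h.L₁ - (1 / 2 : 𝕜) • h.closureSum ∘L h.incl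

theorem skewPart_apply (h : IsT1T2 L₀ Lt₀) (u : h.W) :
    h.skewPart u = h.L₁ u - (1 / 2 : 𝕜) • h.closureSum (h.incl u) := rfl

theorem Lt₁_eq (h : IsT1T2 L₀ Lt₀) (u : h.W) :
    h.Lt₁ u = (1 / 2 : 𝕜) • h.closureSum (h.incl u) - h.skewPart u := by
  rw [eq_sub_of_add_eq' (h.L₁_add_Lt₁ u), skewPart_apply]
  module

theorem form_eq (h : IsT1T2 L₀ Lt₀) (u v : h.W) :
    h.form u v = ⟪h.incl v, h.skewPart u⟫_𝕜 + ⟪h.skewPart v, h.incl u⟫_𝕜 := by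
  simp only [form, h.Lt₁_eq, skewPart_apply, inner_sub_left, inner_sub_right, inner_smul_left,
    inner_smul_right, h.inner_closureSum_left, map_div₀, map_one, map_ofNat]
  ring

theorem form_conj_symm (h : IsT1T2 L₀ Lt₀) (u v : h.W) :
    starRingEnd 𝕜 (h.form u v) = h.form v u := by
  rw [form_eq, form_eq, map_add, inner_conj_symm, inner_conj_symm, add_comm]

theorem re_form_self (h : IsT1T2 L₀ Lt₀) (u : h.W) :
    RCLike.re (h.form u u) = 2 * RCLike.re ⟪h.incl u, h.skewPart u⟫_𝕜 := by
  rw [form_eq, map_add, inner_re_symm (h.skewPart u)]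
  ring

theorem isClosed_perp (h : IsT1T2 L₀ Lt₀) (V : Submodule 𝕜 h.W) :
    IsClosed (h.perp V : Set h.W) := by
  have : (h.perp V : Set h.W) = ⋂ v ∈ V, {u | h.form u v = 0} := by
    ext u
    simp only [Set.mem_iInter]
    exact Iff.rfl
  rw [this]
  refine isClosed_biInter fun v _ => isClosed_eq ?_ continuous_const
  unfold form
  fun_prop

instance completeSpace_W (h : IsT1T2 L₀ Lt₀) : CompleteSpace h.W :=
  GraphSpace.completeSpace _ (LinearPMap.adjoint_isClosed h.dense_domain')

theorem ConditionV.completeSpace {h : IsT1T2 L₀ Lt₀} {V : Submodule 𝕜 h.W}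
    (hV : h.ConditionV V) : CompleteSpace V := by
  have : IsClosed (V : Set h.W) := by
    rw [hV.perp_perp]
    exact h.isClosed_perp _
  exact this.completeSpace_coe

theorem ConditionV.re_inner_skewPart_nonneg {h : IsT1T2 L₀ Lt₀} {V : Submodule 𝕜 h.W}
    (hV : h.ConditionV V) {u : h.W} (hu : u ∈ V) : 0 ≤ RCLike.re ⟪h.incl u, h.skewPart u⟫_𝕜 := by
  have := (RCLike.nonneg_iff.1 (hV.nonneg u hu)).1
  rw [re_form_self] at this
  linarith

/-- The common domain of `L₀` and `L̃₀` lies in every subspace satisfying (V), because it is in the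
kernel of the form. -/
theorem ConditionV.exists_mem {h : IsT1T2 L₀ Lt₀} {V : Submodule 𝕜 h.W}
    (hV : h.ConditionV V) (φ : L₀.domain) : ∃ u ∈ V, h.incl u = φ ∧ h.L₁ u = L₀ φ := by
  have hle := h.formalAdjoint.symm.le_adjoint h.dense_domain'
  let u : h.W := ⟨φ, hle.1 φ.2⟩
  have hu : h.L₁ u = L₀ φ := (hle.2 (x := φ) (y := ⟨φ, hle.1 φ.2⟩) rfl).symm
  refine ⟨u, ?_, rfl, hu⟩
  rw [hV.perp_perp]
  intro v _
  rw [form, hu]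
  have := h.inner_Lt₁ v φ
  exact sub_eq_zero.2 this.symm

theorem realisation_apply (h : IsT1T2 L₀ Lt₀) (V : Submodule 𝕜 h.W) (C : H →L[𝕜] H) (u : V) :
    h.realisation V C u =
      h.skewPart u + (C + (1 / 2 : 𝕜) • h.closureSum) (h.incl u) := by
  change h.L₁ u + C (h.incl u) = _
  rw [skewPart_apply, add_apply, smul_apply]
  abel

/-! ### A priori estimates and invertibility of `L + C` -/

section CoeffClass

variable {h : IsT1T2 L₀ Lt₀} {V : Submodule 𝕜 h.W} {α β : ℝ} {C : H →L[𝕜] H}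

theorem norm_le_of_mem_coeffClass (hβ : 0 < β) (hC : C ∈ h.coeffClass α β) (x : H) :
    ‖(C + (1 / 2 : 𝕜) • h.closureSum) x‖ ≤ β * ‖x‖ := by
  have h1 := mul_norm_le_of_mul_sq_le_re_inner (hC x).2
  rwa [one_div, inv_mul_le_iff₀ hβ] at h1

theorem ConditionV.le_re_inner_realisation (hV : h.ConditionV V) (hC : C ∈ h.coeffClass α β)
    (u : V) :
    α * ‖h.incl u‖ ^ 2 ≤ RCLike.re ⟪h.incl u, h.realisation V C u⟫_𝕜 := by
  rw [realisation_apply, inner_add_right, map_add]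
  linarith [hV.re_inner_skewPart_nonneg u.2, (hC (h.incl u)).1]

theorem ConditionV.norm_incl_le (hV : h.ConditionV V) (hα : 0 < α) (hC : C ∈ h.coeffClass α β)
    (u : V) : ‖h.incl u‖ ≤ α⁻¹ * ‖h.realisation V C u‖ := by
  rw [le_inv_mul_iff₀ hα]
  refine mul_norm_le_of_mul_sq_le_re_inner (𝕜 := 𝕜) ?_
  rw [inner_re_symm]
  exact hV.le_re_inner_realisation hC u

/-- The a priori estimate in the graph norm, uniform over the class of coefficients. -/
theorem ConditionV.norm_le (hV : h.ConditionV V) (hα : 0 < α) (hβ : 0 < β)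
    (hC : C ∈ h.coeffClass α β) (u : V) :
    ‖u‖ ≤ (α⁻¹ + (1 + (β + ‖(1 / 2 : 𝕜) • h.closureSum‖) * α⁻¹)) * ‖h.realisation V C u‖ := by
  have h1 : ‖u‖ ≤ ‖h.incl u‖ + ‖h.L₁ u‖ := GraphSpace.norm_le_add _ (u : h.W)
  have h2 := hV.norm_incl_le hα hC u
  have h3 : h.L₁ u = h.realisation V C u - ((C + (1 / 2 : 𝕜) • h.closureSum) (h.incl u) -
      ((1 / 2 : 𝕜) • h.closureSum) (h.incl u)) := by
    rw [realisation_apply, skewPart_apply, smul_apply]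
    abel
  have h4 : ‖h.L₁ u‖ ≤ ‖h.realisation V C u‖ +
      (β * ‖h.incl u‖ + ‖(1 / 2 : 𝕜) • h.closureSum‖ * ‖h.incl u‖) := by
    rw [h3]
    exact (norm_sub_le _ _).trans (add_le_add_right ((norm_sub_le _ _).trans (add_le_add
      (norm_le_of_mem_coeffClass hβ hC _) (ContinuousLinearMap.le_opNorm _ _))) _)
  have h5 := mul_le_mul_of_nonneg_left h2
    (add_nonneg hβ.le (norm_nonneg ((1 / 2 : 𝕜) • h.closureSum)))
  linarith

/-- A vector orthogonal to the range of `L + C` lies in the domain of the adjoint realisation, on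
which nonpositivity of the form gives the adjoint coercivity estimate. -/
theorem ConditionV.eq_zero_of_forall_inner_realisation (hV : h.ConditionV V) (hα : 0 < α)
    (hC : C ∈ h.coeffClass α β) {f : H} (hf : ∀ u : V, ⟪f, h.realisation V C u⟫_𝕜 = 0) :
    f = 0 := by
  have hadj : ∀ φ : L₀.domain, ⟪-(C.adjoint f), (φ : H)⟫_𝕜 = ⟪f, L₀ φ⟫_𝕜 := by
    intro φ
    obtain ⟨u, huV, h1, h2⟩ := hV.exists_mem φ
    have h3 : ⟪f, h.L₁ u + C (h.incl u)⟫_𝕜 = 0 := hf ⟨u, huV⟩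
    rw [h1, h2, inner_add_right] at h3
    rw [inner_neg_left, ContinuousLinearMap.adjoint_inner_left]
    exact (eq_neg_of_add_eq_zero_left h3).symm
  have hmem : f ∈ Lt₀.adjoint.domain := h.domain_adjoint_eq.ge
    (LinearPMap.mem_adjoint_domain_of_exists f ⟨_, hadj⟩)
  let w : h.W := ⟨f, hmem⟩
  have hw : h.incl w = f := rfl
  have hLt : h.Lt₁ w = -(C.adjoint f) := LinearPMap.adjoint_apply_eq h.dense_domain _ hadj
  have hperp : w ∈ h.perp V := by
    intro v hv
    have h3 : ⟪f, h.L₁ v + C (h.incl v)⟫_𝕜 = 0 := hf ⟨v, hv⟩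
    rw [← h.form_conj_symm, form, hLt, hw, inner_neg_left,
      ContinuousLinearMap.adjoint_inner_left, sub_neg_eq_add, ← inner_add_right, h3, map_zero]
  have h1 := (RCLike.nonpos_iff.1 (hV.nonpos w hperp)).1
  rw [re_form_self, hw] at h1
  have h2 : h.skewPart w = (1 / 2 : 𝕜) • h.closureSum f + C.adjoint f := by
    have := h.Lt₁_eq w
    rw [hLt, hw] at this
    rw [eq_sub_iff_add_eq] at this
    rw [← this]
    abel
  have h3 := (hC f).1
  have h4 : RCLike.re ⟪f, C.adjoint f⟫_𝕜 = RCLike.re ⟪f, C f⟫_𝕜 := by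
    rw [ContinuousLinearMap.adjoint_inner_right, inner_re_symm]
  rw [h2, inner_add_right, map_add, h4] at h1
  rw [add_apply, smul_apply, inner_add_right, map_add]
    at h3
  have h5 : ‖f‖ ^ 2 ≤ 0 := by nlinarith
  exact norm_eq_zero.1 (pow_eq_zero_iff two_ne_zero |>.1 (le_antisymm h5 (sq_nonneg _)))

theorem ConditionV.isInvertible_realisation (hV : h.ConditionV V) (hα : 0 < α) (hβ : 0 < β)
    (hC : C ∈ h.coeffClass α β) : (h.realisation V C).IsInvertible := by
  have := hV.completeSpace
  have hbij : Function.Bijective (h.realisation V C) := by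
    rw [ContinuousLinearMap.bijective_iff_dense_range_and_antilipschitz]
    refine ⟨?_, (α⁻¹ + (1 + (β + ‖(1 / 2 : 𝕜) • h.closureSum‖) * α⁻¹)).toNNReal,
      ContinuousLinearMap.antilipschitz_of_bound _ fun u => ?_⟩
    · rw [Submodule.topologicalClosure_eq_top_iff, Submodule.eq_bot_iff]
      intro f hf
      refine hV.eq_zero_of_forall_inner_realisation hα hC fun u => ?_
      exact (Submodule.mem_orthogonal' _ _).1 hf _ ⟨u, rfl⟩
    · rw [Real.coe_toNNReal _ (by positivity)]
      exact hV.norm_le hα hβ hC u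
  exact ⟨ContinuousLinearEquiv.ofBijective _ (LinearMap.ker_eq_bot.2 hbij.1)
    (LinearMap.range_eq_top.2 hbij.2), ContinuousLinearEquiv.coe_ofBijective _ _ _⟩

end CoeffClass

end IsT1T2
end PairLemmas

/-! ### Passing to the limit -/

section Limit

variable {𝕜 : Type*} [RCLike 𝕜] {H : Type*} [NormedAddCommGroup H] [InnerProductSpace 𝕜 H]
variable [CompleteSpace H] {L₀ Lt₀ : H →ₗ.[𝕜] H}

namespace IsT1T2

variable {h : IsT1T2 L₀ Lt₀} {V : Submodule 𝕜 h.W} {α β : ℝ}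

/-- The coercivity estimates of the coefficient class pass to a weak limit: if `uₙ ⇀ u` weakly and
`(L + Cₙ) uₙ = f`, then `w = f - (L₁ - ½ S) u`, the weak limit of `(Cₙ + ½ S) uₙ`, satisfies the same
inequalities with respect to `u`. Monotonicity of `L₁ - ½ S` on `V` replaces the compactness
of the embedding of `V` in `H`. -/
theorem ConditionV.coercive_of_tendsto (hV : h.ConditionV V) (hα : 0 < α) (hβ : 0 < β)
    {C : ℕ → H →L[𝕜] H} (hC : ∀ n, C n ∈ h.coeffClass α β) {u : ℕ → V} {u' : V} {f : H}
    (hu : ∀ n, h.realisation V (C n) (u n) = f)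
    (hlim : ∀ y, Tendsto (fun n => ⟪u n, y⟫_𝕜) atTop (𝓝 ⟪u', y⟫_𝕜)) :
    α * ‖h.incl u'‖ ^ 2 ≤ RCLike.re ⟪h.incl u', f - h.skewPart u'⟫_𝕜 ∧
    1 / β * ‖f - h.skewPart u'‖ ^ 2 ≤ RCLike.re ⟪h.incl u', f - h.skewPart u'⟫_𝕜 := by
  have := hV.completeSpace
  have hmap : ∀ (g : V →L[𝕜] H) (z : H),
      Tendsto (fun n => ⟪g (u n), z⟫_𝕜) atTop (𝓝 ⟪g u', z⟫_𝕜) := fun g z => by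
    simpa only [ContinuousLinearMap.adjoint_inner_right] using hlim (g.adjoint z)
  have hi : ∀ z, Tendsto (fun n => ⟪h.incl (u n), z⟫_𝕜) atTop (𝓝 ⟪h.incl u', z⟫_𝕜) :=
    hmap (h.incl ∘L V.subtypeL)
  have hs : ∀ z, Tendsto (fun n => ⟪h.skewPart (u n), z⟫_𝕜) atTop (𝓝 ⟪h.skewPart u', z⟫_𝕜) :=
    hmap (h.skewPart ∘L V.subtypeL)
  have hre : ∀ {a : ℕ → 𝕜} {b : 𝕜}, Tendsto a atTop (𝓝 b) →
      Tendsto (fun n => RCLike.re (a n)) atTop (𝓝 (RCLike.re b)) :=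
    fun ha => (RCLike.continuous_re.tendsto _).comp ha
  have hw : ∀ n, (C n + (1 / 2 : 𝕜) • h.closureSum) (h.incl (u n)) = f - h.skewPart (u n) :=
    fun n => by rw [← hu n, realisation_apply, add_sub_cancel_left]
  -- An upper bound for `re ⟪uₙ, f - M uₙ⟫`, where `M = L₁ - ½ S`, that is affine in `uₙ`.
  let r : ℕ → ℝ := fun n => RCLike.re ⟪h.incl (u n), f⟫_𝕜 -
    RCLike.re ⟪h.incl (u n), h.skewPart u'⟫_𝕜 - RCLike.re ⟪h.skewPart (u n), h.incl u'⟫_𝕜 +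
    RCLike.re ⟪h.incl u', h.skewPart u'⟫_𝕜
  have hr : Tendsto r atTop (𝓝 (RCLike.re ⟪h.incl u', f - h.skewPart u'⟫_𝕜)) := by
    have := (((hre (hi f)).sub (hre (hi (h.skewPart u')))).sub
      (hre (hs (h.incl u')))).add_const (RCLike.re ⟪h.incl u', h.skewPart u'⟫_𝕜)
    convert this using 2
    rw [inner_sub_right, map_sub, inner_re_symm (h.skewPart u')]
    ring
  have hle : ∀ n, RCLike.re ⟪h.incl (u n), f - h.skewPart (u n)⟫_𝕜 ≤ r n := by
    intro n
    have := hV.re_inner_skewPart_nonneg (u n - u').2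
    simp only [Submodule.coe_sub, map_sub, inner_sub_left, inner_sub_right] at this
    simp only [r, inner_sub_right, map_sub]
    rw [inner_re_symm (h.skewPart (u n))]
    linarith
  refine ⟨norm_sq_le_of_tendsto_inner hi hα.le hr fun n => ?_,
    norm_sq_le_of_tendsto_inner (𝕜 := 𝕜) (x := fun n => f - h.skewPart (u n)) (fun y => ?_)
      (one_div_pos.2 hβ).le hr fun n => ?_⟩
  · have := (hC n (h.incl (u n))).1
    rw [hw] at this
    exact this.trans (hle n)
  · simpa only [inner_sub_left] using (hs y).const_sub ⟪f, y⟫_𝕜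
  · have := (hC n (h.incl (u n))).2
    rw [hw] at this
    exact this.trans (hle n)

/-- If the right-hand sides `f` and the solutions `B f` satisfy the coercivity estimates, then `B`
solves the equation for some coefficient of the class: `(L + C) B = id`. -/
theorem exists_realisation_comp_eq_id (hα : 0 < α) (hβ : 0 < β)
    (hV : h.ConditionV V) (B : H →L[𝕜] V)
    (h₁ : ∀ f, α * ‖h.incl (B f)‖ ^ 2 ≤ RCLike.re ⟪h.incl (B f), f - h.skewPart (B f)⟫_𝕜)
    (h₂ : ∀ f, 1 / β * ‖f - h.skewPart (B f)‖ ^ 2 ≤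
      RCLike.re ⟪h.incl (B f), f - h.skewPart (B f)⟫_𝕜) :
    ∃ C ∈ h.coeffClass α β, ∀ f, h.realisation V C (B f) = f := by
  let b : H →L[𝕜] H := h.incl ∘L V.subtypeL ∘L B
  let w : H →L[𝕜] H := ContinuousLinearMap.id 𝕜 H - h.skewPart ∘L V.subtypeL ∘L B
  have hbw : ∀ f, ‖w f‖ ≤ β * ‖b f‖ := by
    intro f
    have h1 : 1 / β * ‖w f‖ ≤ ‖b f‖ := mul_norm_le_of_mul_sq_le_re_inner (h₂ f)
    rwa [one_div, inv_mul_le_iff₀ hβ] at h1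
  -- A vector `g` orthogonal to the range of `b` satisfies `re ⟪b g, w g⟫ ≤ 0`, which forces
  -- `b g = 0`, then `w g = 0`, and so `g = w g + M (B g) = 0`.
  have hdense : DenseRange b := by
    have hbot : b.rangeᗮ = ⊥ := by
      rw [Submodule.eq_bot_iff]
      intro g hg
      have h0 : ⟪b g, g⟫_𝕜 = 0 := (Submodule.mem_orthogonal _ _).1 hg _ ⟨g, rfl⟩
      have h1 : α * ‖b g‖ ^ 2 ≤ RCLike.re ⟪b g, g - h.skewPart (B g)⟫_𝕜 := h₁ g
      rw [inner_sub_right, map_sub, h0, map_zero] at h1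
      have h2 : 0 ≤ RCLike.re ⟪b g, h.skewPart (B g)⟫_𝕜 := hV.re_inner_skewPart_nonneg (B g).2
      have h3 : ‖b g‖ ^ 2 ≤ 0 := by nlinarith
      have h4 : b g = 0 :=
        norm_eq_zero.1 (pow_eq_zero_iff two_ne_zero |>.1 (le_antisymm h3 (sq_nonneg _)))
      have h5 : w g = 0 := by
        have := hbw g
        rw [h4, norm_zero, mul_zero] at this
        exact norm_le_zero_iff.1 this
      have h6 : B g = 0 := Subtype.ext (Subtype.ext h4)
      have h7 : w g = g - h.skewPart (B g) := rfl
      rw [h5, h6, Submodule.coe_zero, map_zero, sub_zero] at h7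
      exact h7.symm
    have := Submodule.dense_iff_topologicalClosure_eq_top.2
      (b.range.topologicalClosure_eq_top_iff.2 hbot)
    exact this
  -- The coefficient `A` is determined on the dense range of `b` by `A (b f) = w f`.
  let A : H →L[𝕜] H := (w : H →ₗ[𝕜] H).extendOfNorm (b : H →ₗ[𝕜] H)
  have hA : ∀ f, A (b f) = w f := (w : H →ₗ[𝕜] H).extendOfNorm_eq hdense ⟨β, hbw⟩
  refine ⟨A - (1 / 2 : 𝕜) • h.closureSum, fun φ => ?_, fun f => ?_⟩
  · rw [sub_add_cancel]
    refine hdense.induction_on (p := fun φ => α * ‖φ‖ ^ 2 ≤ RCLike.re ⟪φ, A φ⟫_𝕜 ∧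
      1 / β * ‖A φ‖ ^ 2 ≤ RCLike.re ⟪φ, A φ⟫_𝕜) φ ?_ fun f => ?_
    · exact (isClosed_le (by fun_prop) (RCLike.continuous_re.comp (by fun_prop))).inter
        (isClosed_le (by fun_prop) (RCLike.continuous_re.comp (by fun_prop)))
    · rw [hA]
      exact ⟨h₁ f, h₂ f⟩
  · have : A (h.incl (B f)) = f - h.skewPart (B f) := hA f
    rw [realisation_apply, sub_add_cancel, this, add_sub_cancel]

end IsT1T2
end Limit
end AbstractFriedrichs

theorem theorem2p5 {𝕜 : Type*} [RCLike 𝕜] {H : Type*} [NormedAddCommGroup H]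
    [InnerProductSpace 𝕜 H] [CompleteSpace H] [TopologicalSpace.SeparableSpace H]
    (L₀ Lt₀ : H →ₗ.[𝕜] H) (h : AbstractFriedrichs.IsT1T2 L₀ Lt₀)
    (V : Submodule 𝕜 h.W) (hV : h.ConditionV V)
    (α β : ℝ) (hα : 0 < α) (hαβ : α < β)
    (C : ℕ → H →L[𝕜] H) (hC : ∀ n, C n ∈ h.coeffClass α β) :
    ∃ Climit ∈ h.coeffClass α β, ∃ k : ℕ → ℕ, StrictMono k ∧
      h.GConverges V (fun n => C (k n)) Climit := by
  have hβ := hα.trans hαβ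
  have := hV.completeSpace
  have hinv := fun n => hV.isInvertible_realisation hα hβ (hC n)
  obtain ⟨k, B, hk, hlim⟩ := AbstractFriedrichs.exists_subseq_tendsto_inner
    (fun n => (h.realisation V (C n)).inverse)
    (M := α⁻¹ + (1 + (β + ‖(1 / 2 : 𝕜) • h.closureSum‖) * α⁻¹)) (by positivity) fun n f => by
      have := hV.norm_le hα hβ (hC n) ((h.realisation V (C n)).inverse f)
      rwa [(hinv n).self_apply_inverse] at this
  have hcoer := fun f => hV.coercive_of_tendsto hα hβ (fun n => hC (k n))
    (fun n => (hinv (k n)).self_apply_inverse f) (hlim f)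
  obtain ⟨C', hC', hB⟩ := AbstractFriedrichs.IsT1T2.exists_realisation_comp_eq_id hα hβ hV B
    (fun f => (hcoer f).1) fun f => (hcoer f).2
  have hinv' := hV.isInvertible_realisation hα hβ hC'
  refine ⟨C', hC', k, hk, fun n => hinv (k n), hinv', fun f => ?_⟩
  rw [(hinv'.inverse_apply_eq).2 (hB f).symm]
  exact AbstractFriedrichs.tendsto_toWeakSpace_of_tendsto_inner (hlim f)
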